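/- Let $n\ge 1$, let $H_n$ be an $n$-dimensional complex Hilbert space with orthonormal basis $e_1,\dots,e_n$, and let $F^2(H_n)=\bigoplus_{k\ge0}H_n^{\otimes k}$ be its full Fock space (with $H_n^{\otimes 0}=\mathbb C 1$); it has the orthonormal basis $e_\alpha=e_{i_1}\otimes\cdots\otimes e_{i_k}$ indexed by the words $\alpha=g_{i_1}\cdots g_{i_k}$ of the free monoid $\mathbb F_n^+$ on $g_1,\dots,g_n$ (with $e_\alpha=1$ for the empty word), through which it is identified with $\ell^2(\mathbb F_n^+)$. Let $S_i\varphi=e_i\otimes\varphi$ and $R_i\varphi=\varphi\otimes e_i$ ($i=1,\dots,n$) be the left and right creation operators on $F^2(H_n)$, and let the noncommutative disc algebra $\mathcal A_n\subset B(F^2(H_n))$ be the norm closed algebra generated by $S_1,\dots,S_n$ and the identity. Let $\mathcal E$ be a complex Hilbert space, and let $\mathcal A_n(\mathcal E)=B(\mathcal E)\otimes_{min}\mathcal A_n$ be the spatial tensor product, i.e. the norm closure in $B(\mathcal E\otimes F^2(H_n))$ of the linear span of the operators $Y\otimes T$ with $Y\in B(\mathcal E)$, $T\in\mathcal A_n$.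 Put $\mathcal A_n(\mathcal E)^*+\mathcal A_n(\mathcal E)=\{P^*+Q: P,Q\in\mathcal A_n(\mathcal E)\}$. An operator $A\in B(\mathcal E\otimes F^2(H_n))$ is called multi-Toeplitz if $$(I_{\mathcal E}\otimes R_i^*)\,A\,(I_{\mathcal E}\otimes R_j)=\delta_{ij}A\qquad\text{for all } i,j=1,\dots,n.$$ Then the set of all multi-Toeplitz operators on $\mathcal E\otimes F^2(H_n)$ coincides with $$\overline{\mathcal A_n(\mathcal E)^*+\mathcal A_n(\mathcal E)}^{\,WOT}=\overline{\mathcal A_n(\mathcal E)^*+\mathcal A_n(\mathcal E)}^{\,SOT},$$ where the closures are taken in $B(\mathcal E\otimes F^2(H_n))$ in the weak and in the strong operator topology respectively. -/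

import Mathlib

open scoped TensorProduct

noncomputable section

/-- The full Fock space `F²(H_n)` on `n` generators. The words `α = g_{i₁} ⋯ g_{iₖ}` of the unital
free semigroup `𝔽ₙ⁺` are the elements of `FreeMonoid (Fin n)`, and `F²(H_n)` is written in
coordinates with respect to its orthonormal basis `e_α = e_{i₁} ⊗ ⋯ ⊗ e_{iₖ}` (`e_α = 1` for the
empty word), that is, as the Hilbert space `ℓ²(𝔽ₙ⁺)`. -/
abbrev Fock (n : ℕ) : Type := lp (fun _ : FreeMonoid (Fin n) => ℂ) 2

/-- The orthonormal basis `(e_α)` of the full Fock space, indexed by words. -/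
def fockBasis (n : ℕ) : HilbertBasis (FreeMonoid (Fin n)) ℂ (Fock n) :=
  HilbertBasis.ofRepr (LinearIsometryEquiv.refl ℂ (Fock n))

/-- For an injective map `σ` of words, the isometry of the Fock space with `e_α ↦ e_{σ α}`. -/
def fockIsometry {n : ℕ} (σ : FreeMonoid (Fin n) → FreeMonoid (Fin n))
    (hσ : Function.Injective σ) : Fock n →ₗᵢ[ℂ] Fock n :=
  ((fockBasis n).orthonormal.comp σ hσ).orthogonalFamily.linearIsometry

/-- The left creation operator `S_i φ = e_i ⊗ φ`, i.e. `S_i e_α = e_{g_i α}`. -/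
def leftCreation {n : ℕ} (i : Fin n) : Fock n →L[ℂ] Fock n :=
  (fockIsometry (fun α => FreeMonoid.of i * α)
    (fun _ _ h => mul_left_cancel h)).toContinuousLinearMap

/-- The right creation operator `R_i φ = φ ⊗ e_i`, i.e. `R_i e_α = e_{α g_i}`. -/
def rightCreation {n : ℕ} (i : Fin n) : Fock n →L[ℂ] Fock n :=
  (fockIsometry (fun α => α * FreeMonoid.of i)
    (fun _ _ h => mul_right_cancel h)).toContinuousLinearMap

theorem fockIsometry_basis {n : ℕ} (σ : FreeMonoid (Fin n) → FreeMonoid (Fin n))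
    (hσ : Function.Injective σ) (α : FreeMonoid (Fin n)) :
    fockIsometry σ hσ (fockBasis n α) = fockBasis n (σ α) := by
  classical
  have h : (fockBasis n α : Fock n) = lp.single 2 α (1 : ℂ) := by
    rw [← (fockBasis n).repr_self α]; rfl
  rw [h, fockIsometry, OrthogonalFamily.linearIsometry_apply_single]
  simp

theorem leftCreation_basis {n : ℕ} (i : Fin n) (α : FreeMonoid (Fin n)) :
    leftCreation i (fockBasis n α) = fockBasis n (FreeMonoid.of i * α) :=
  fockIsometry_basis _ (fun _ _ h => mul_left_cancel h) α

theorem rightCreation_basis {n : ℕ} (i : Fin n) (α : FreeMonoid (Fin n)) :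
    rightCreation i (fockBasis n α) = fockBasis n (α * FreeMonoid.of i) :=
  fockIsometry_basis _ (fun _ _ h => mul_right_cancel h) α

/-- The noncommutative disc algebra `𝒜_n`: the norm closed algebra generated by the left creation
operators `S_1, …, S_n` and the identity. -/
def discAlgebra (n : ℕ) : Subalgebra ℂ (Fock n →L[ℂ] Fock n) :=
  (Algebra.adjoin ℂ (Set.range (leftCreation (n := n)))).topologicalClosure

/-- The Hilbert space tensor product of two Hilbert spaces: the completion of the algebraic
tensor product for the inner product `⟪x ⊗ y, x' ⊗ y'⟫ = ⟪x, x'⟫ ⟪y, y'⟫`. -/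
abbrev HilbertTensor (E F : Type*) [NormedAddCommGroup E] [InnerProductSpace ℂ E]
    [NormedAddCommGroup F] [InnerProductSpace ℂ F] : Type _ :=
  UniformSpace.Completion (E ⊗[ℂ] F)

/-- The tensor product `Y ⊗ T` of bounded operators, acting on the Hilbert space tensor product by
`(Y ⊗ T) (x ⊗ y) = Y x ⊗ T y`. -/
def opTensor {E F : Type*} [NormedAddCommGroup E] [InnerProductSpace ℂ E]
    [NormedAddCommGroup F] [InnerProductSpace ℂ F] (Y : E →L[ℂ] E) (T : F →L[ℂ] F) :
    HilbertTensor E F →L[ℂ] HilbertTensor E F :=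
  (TensorProduct.mapL Y T).completion

section

variable (n : ℕ) (E : Type*) [NormedAddCommGroup E] [InnerProductSpace ℂ E] [CompleteSpace E]

/-- `A ∈ B(E ⊗ F²(H_n))` is multi-Toeplitz (with respect to the right creation operators) if
`(I ⊗ R_i^*) A (I ⊗ R_j) = δ_{ij} A` for all `i, j`. -/
def IsMultiToeplitz (A : HilbertTensor E (Fock n) →L[ℂ] HilbertTensor E (Fock n)) : Prop :=
  ∀ i j : Fin n,
    opTensor (ContinuousLinearMap.id ℂ E) (ContinuousLinearMap.adjoint (rightCreation i)) ∘L A ∘L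
      opTensor (ContinuousLinearMap.id ℂ E) (rightCreation j) = if i = j then A else 0

/-- The spatial tensor product `𝒜_n(E) = B(E) ⊗_min 𝒜_n`: the norm closure in `B(E ⊗ F²(H_n))` of
the linear span of the operators `Y ⊗ T` with `Y ∈ B(E)` and `T ∈ 𝒜_n`. -/
def discAlgebraTensor :
    Submodule ℂ (HilbertTensor E (Fock n) →L[ℂ] HilbertTensor E (Fock n)) :=
  (Submodule.span ℂ
    {X | ∃ Y : E →L[ℂ] E, ∃ T ∈ discAlgebra n, X = opTensor Y T}).topologicalClosure

/-- The set `𝒜_n(E)^* + 𝒜_n(E) = {P^* + Q : P, Q ∈ 𝒜_n(E)}`. -/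
def discOperatorSystem : Set (HilbertTensor E (Fock n) →L[ℂ] HilbertTensor E (Fock n)) :=
  {X | ∃ P ∈ discAlgebraTensor n E, ∃ Q ∈ discAlgebraTensor n E,
    X = ContinuousLinearMap.adjoint P + Q}

end

/-- The closure of a set of bounded operators in the strong operator topology, that is, the topology
of pointwise convergence in norm. -/
def sotClosure {K : Type*} [NormedAddCommGroup K] [InnerProductSpace ℂ K] (M : Set (K →L[ℂ] K)) :
    Set (K →L[ℂ] K) :=
  {A | ContinuousLinearMap.toPointwiseConvergenceCLM ℂ (RingHom.id ℂ) K K A ∈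
    closure (ContinuousLinearMap.toPointwiseConvergenceCLM ℂ (RingHom.id ℂ) K K '' M)}

/-- The closure of a set of bounded operators in the weak operator topology. -/
def wotClosure {K : Type*} [NormedAddCommGroup K] [InnerProductSpace ℂ K] (M : Set (K →L[ℂ] K)) :
    Set (K →L[ℂ] K) :=
  {A | (ContinuousLinearMapWOT.ofCLM A : K →WOT[ℂ] K) ∈
    closure ((ContinuousLinearMapWOT.ofCLM : (K →L[ℂ] K) → (K →WOT[ℂ] K)) '' M)}

end

/-! Write an operator on `E ⊗ F²(H_n)` as a block matrix `A_{γ,β} ∈ B(E)` indexed by words. The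
multi-Toeplitz condition says that cancelling a common last letter of `γ` and `β` leaves the entry
unchanged, and that distinct last letters force it to vanish. So `A` is formally the sum of `A_{α,1}
⊗ S_α` over all `α` and `A_{1,α} ⊗ S_α^*` over `α ≠ 1`. This series need not converge, but its Fejér
means, with weights `(1 - |α|/N)⁺`, are finite sums in the operator system.

They converge strongly to `A` for two reasons. By `coord_fejerMean` they multiply the entry at
`(γ,β)` by a weight in `[0,1]` tending to `1`, which gives convergence on each `x ⊗ e_β`. By
`norm_fejerMean_le` they are bounded by `‖A‖`: the mean is `(1/N) ∑ P_m A P_m`, where `P_m` projects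
onto the words with `m - N < |α| ≤ m`, and each word lies in `N` windows.

Conversely, `𝒜_n` commutes with every `R_j`, and `R_i^* R_j = δ_{ij}`, so the operator system is
multi-Toeplitz; the condition is WOT closed, and SOT closures lie in WOT closures. -/

noncomputable section

open scoped TensorProduct InnerProductSpace Topology
open Filter

/-! ### Block matrices over a Hilbert sum: norm bounds and strong convergence -/

section HilbertSum

variable {ι E K : Type*} [NormedAddCommGroup E] [InnerProductSpace ℂ E] [CompleteSpace E]
  [NormedAddCommGroup K] [InnerProductSpace ℂ K] [CompleteSpace K] {V : ι → E →ₗᵢ[ℂ] K}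

/-- The coordinate of a vector of `K` along the isometry `V i : E → K`. -/
def coord (V : ι → E →ₗᵢ[ℂ] K) (i : ι) : K →L[ℂ] E :=
  ContinuousLinearMap.adjoint (V i).toContinuousLinearMap

theorem inner_coord_right (i : ι) (x : E) (u : K) : ⟪x, coord V i u⟫_ℂ = ⟪V i x, u⟫_ℂ :=
  ContinuousLinearMap.adjoint_inner_right _ _ _

theorem inner_coord_left (i : ι) (x : E) (u : K) : ⟪coord V i u, x⟫_ℂ = ⟪u, V i x⟫_ℂ :=
  ContinuousLinearMap.adjoint_inner_left _ _ _

theorem linearIsometryEquiv_apply_eq_coord (hV : IsHilbertSum ℂ (fun _ : ι => E) V) (u : K)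
    (i : ι) : hV.linearIsometryEquiv u i = coord V i u := by
  classical
  refine ext_inner_left ℂ fun x => ?_
  rw [inner_coord_right]
  refine (lp.inner_single_left (𝕜 := ℂ) i x (hV.linearIsometryEquiv u)).symm.trans ?_
  rw [← hV.linearIsometryEquiv.symm.inner_map_map, LinearIsometryEquiv.symm_apply_apply,
    hV.linearIsometryEquiv_symm_apply_single]

theorem hasSum_norm_coord_sq (hV : IsHilbertSum ℂ (fun _ : ι => E) V) (u : K) :
    HasSum (fun i => ‖coord V i u‖ ^ 2) (‖u‖ ^ 2) := by
  have h := lp.hasSum_norm (p := 2) (by simp) (hV.linearIsometryEquiv u)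
  simpa [linearIsometryEquiv_apply_eq_coord] using h

omit [CompleteSpace E] in
theorem dense_span_range (hV : IsHilbertSum ℂ (fun _ : ι => E) V) :
    Dense (Submodule.span ℂ {u | ∃ i x, V i x = u} : Set K) := by
  intro u
  have hu := hV.hasSum_linearIsometryEquiv_symm (hV.linearIsometryEquiv u)
  rw [LinearIsometryEquiv.symm_apply_apply] at hu
  exact mem_closure_of_tendsto hu (Eventually.of_forall fun s =>
    Submodule.sum_mem _ fun i _ => Submodule.subset_span ⟨i, _, rfl⟩)

/-- The projection onto the span of the summands with index in `s`. -/
def partialProj (V : ι → E →ₗᵢ[ℂ] K) (s : Finset ι) : K →L[ℂ] K :=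
  ∑ i ∈ s, (V i).toContinuousLinearMap ∘L coord V i

theorem partialProj_apply (s : Finset ι) (u : K) :
    partialProj V s u = ∑ i ∈ s, V i (coord V i u) := by
  simp [partialProj]

theorem norm_partialProj_sq (hV : OrthogonalFamily ℂ (fun _ : ι => E) V) (s : Finset ι) (u : K) :
    ‖partialProj V s u‖ ^ 2 = ∑ i ∈ s, ‖coord V i u‖ ^ 2 := by
  rw [partialProj_apply, hV.norm_sum]

theorem partialProj_map [DecidableEq ι] (hV : OrthogonalFamily ℂ (fun _ : ι => E) V)
    (s : Finset ι) (i : ι) (x : E) : partialProj V s (V i x) = if i ∈ s then V i x else 0 := by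
  have hc : ∀ j, coord V j (V i x) = if i = j then x else 0 := fun j =>
    ext_inner_left ℂ fun y => by
      rw [inner_coord_right]
      split_ifs with hij
      · subst hij; exact (V i).inner_map_map _ _
      · rw [inner_zero_right]; exact hV (Ne.symm hij) _ _
  rw [partialProj_apply, ← Finset.sum_ite_eq s i (fun _ => V i x)]
  refine Finset.sum_congr rfl fun j _ => ?_
  rw [hc]
  split_ifs with hij
  · rw [hij]
  · rw [map_zero]

/-- Bessel's inequality for a family of windows covering each index at most `N` times. -/
theorem sum_norm_partialProj_sq_le [DecidableEq ι] (hV : IsHilbertSum ℂ (fun _ : ι => E) V)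
    (W : ℕ → Finset ι) (N : ℕ)
    (hW : ∀ i M, ((Finset.range M).filter fun m => i ∈ W m).card ≤ N) (M : ℕ) (u : K) :
    ∑ m ∈ Finset.range M, ‖partialProj V (W m) u‖ ^ 2 ≤ N * ‖u‖ ^ 2 := by
  set s := (Finset.range M).biUnion W
  have h1 : ∀ m ∈ Finset.range M, ‖partialProj V (W m) u‖ ^ 2 =
      ∑ i ∈ s, if i ∈ W m then ‖coord V i u‖ ^ 2 else 0 := fun m hm => by
    rw [norm_partialProj_sq hV.OrthogonalFamily, ← Finset.sum_filter]
    refine Finset.sum_congr ?_ fun _ _ => rfl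
    ext i
    simp only [Finset.mem_filter, s, Finset.mem_biUnion]
    exact ⟨fun h => ⟨⟨m, hm, h⟩, h⟩, fun h => h.2⟩
  rw [Finset.sum_congr rfl h1, Finset.sum_comm]
  calc _ = ∑ i ∈ s, (((Finset.range M).filter fun m => i ∈ W m).card : ℝ) * ‖coord V i u‖ ^ 2 := by
        refine Finset.sum_congr rfl fun i _ => ?_
        rw [← Finset.sum_filter, Finset.sum_const, nsmul_eq_mul]
    _ ≤ ∑ i ∈ s, (N : ℝ) * ‖coord V i u‖ ^ 2 := by
        gcongr with i _; exact hW i M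
    _ ≤ N * ‖u‖ ^ 2 := by
        rw [← Finset.mul_sum]
        gcongr
        exact sum_le_hasSum s (fun _ _ => by positivity) (hasSum_norm_coord_sq hV u)

/-- If the matrix of `T` is the entrywise average of the compressions of `A` to windows covering
each index at most `N` times, then `‖T‖ ≤ ‖A‖`. -/
theorem opNorm_le_of_window_average [DecidableEq ι] (hV : IsHilbertSum ℂ (fun _ : ι => E) V)
    (W : ℕ → Finset ι) {N : ℕ} (hN : 0 < N)
    (hW : ∀ i M, ((Finset.range M).filter fun m => i ∈ W m).card ≤ N) (A T : K →L[ℂ] K)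
    (hT : ∀ i j x, ∀ᶠ M in atTop, (N : ℂ) • coord V j (T (V i x)) =
      (((Finset.range M).filter fun m => i ∈ W m ∧ j ∈ W m).card : ℂ) • coord V j (A (V i x))) :
    ‖T‖ ≤ ‖A‖ := by
  have hN' : (0 : ℝ) < N := by exact_mod_cast hN
  -- How many windows are needed depends on `u` and `v`; the estimate below does not involve `M`, so
  -- one suitable `M` per pair suffices.
  have key : ∀ u ∈ Submodule.span ℂ {u | ∃ i x, V i x = u},
      ∀ v ∈ Submodule.span ℂ {u | ∃ i x, V i x = u}, ∀ᶠ M in atTop,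
      (N : ℂ) * ⟪v, T u⟫_ℂ = ∑ m ∈ Finset.range M,
        ⟪partialProj V (W m) v, A (partialProj V (W m) u)⟫_ℂ := by
    intro u hu v hv
    induction hu using Submodule.span_induction with
    | zero => simp
    | add u u' _ _ h h' =>
      filter_upwards [h, h'] with M h h'
      simp only [map_add, inner_add_right, mul_add, Finset.sum_add_distrib, h, h']
    | smul c u _ h =>
      filter_upwards [h] with M h
      simp only [map_smul, inner_smul_right, ← Finset.mul_sum, ← h]
      ring
    | mem u hu =>
    obtain ⟨i, x, rfl⟩ := hu
    induction hv using Submodule.span_induction with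
    | zero => simp
    | add u u' _ _ h h' =>
      filter_upwards [h, h'] with M h h'
      simp only [map_add, inner_add_left, mul_add, Finset.sum_add_distrib, h, h']
    | smul c u _ h =>
      filter_upwards [h] with M h
      simp only [map_smul, inner_smul_left, ← Finset.mul_sum, ← h]
      ring
    | mem v hv =>
    obtain ⟨j, y, rfl⟩ := hv
    filter_upwards [hT i j x] with M hM
    have h := congrArg (fun z => ⟪y, z⟫_ℂ) hM
    simp only [inner_smul_right, inner_coord_right] at h
    rw [h, Finset.card_filter, Nat.cast_sum, Finset.sum_mul]
    refine Finset.sum_congr rfl fun m _ => ?_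
    rw [partialProj_map hV.OrthogonalFamily, partialProj_map hV.OrthogonalFamily]
    by_cases hi : i ∈ W m <;> by_cases hj : j ∈ W m <;> simp [hi, hj]
  have bound : ∀ u ∈ Submodule.span ℂ {u | ∃ i x, V i x = u},
      ∀ v ∈ Submodule.span ℂ {u | ∃ i x, V i x = u}, ‖⟪v, T u⟫_ℂ‖ ≤ ‖A‖ * ‖u‖ * ‖v‖ := by
    intro u hu v hv
    obtain ⟨M, hM⟩ := (key u hu v hv).exists
    have h1 : (N : ℝ) * ‖⟪v, T u⟫_ℂ‖ ≤ ∑ m ∈ Finset.range M,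
        ‖A‖ * (‖partialProj V (W m) v‖ * ‖partialProj V (W m) u‖) := by
      have := congrArg norm hM
      rw [norm_mul, Complex.norm_natCast] at this
      rw [this]
      refine (norm_sum_le _ _).trans (Finset.sum_le_sum fun m _ => ?_)
      refine (norm_inner_le_norm _ _).trans ?_
      have := A.le_opNorm (partialProj V (W m) u)
      calc _ ≤ ‖partialProj V (W m) v‖ * (‖A‖ * ‖partialProj V (W m) u‖) := by gcongr
        _ = _ := by ring
    rw [← Finset.mul_sum] at h1
    have h2 : ∑ m ∈ Finset.range M, ‖partialProj V (W m) v‖ * ‖partialProj V (W m) u‖ ≤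
        N * (‖u‖ * ‖v‖) := by
      -- Cauchy–Schwarz in squared form; each of the two factors contributes one `N` through
      -- Bessel's inequality.
      refine abs_le_of_sq_le_sq' ?_ (by positivity) |>.2
      refine (Finset.sum_mul_sq_le_sq_mul_sq _ _ _).trans ?_
      calc _ ≤ (N * ‖v‖ ^ 2) * (N * ‖u‖ ^ 2) := by
            gcongr
            · exact sum_norm_partialProj_sq_le hV W N hW M v
            · exact sum_norm_partialProj_sq_le hV W N hW M u
        _ = _ := by ring
    refine le_of_mul_le_mul_left ?_ hN'
    calc _ ≤ _ := h1
      _ ≤ ‖A‖ * (N * (‖u‖ * ‖v‖)) := by gcongr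
      _ = _ := by ring
  have hD := dense_span_range hV
  have bound' : ∀ u v : K, ‖⟪v, T u⟫_ℂ‖ ≤ ‖A‖ * ‖u‖ * ‖v‖ := fun u v => by
    have hc : IsClosed {p : K × K | ‖⟪p.2, T p.1⟫_ℂ‖ ≤ ‖A‖ * ‖p.1‖ * ‖p.2‖} :=
      isClosed_le (by fun_prop) (by fun_prop)
    exact hc.closure_subset_iff.2 (fun p hp => bound p.1 hp.1 p.2 hp.2)
      ((hD.prod hD) (u, v))
  refine T.opNorm_le_bound (norm_nonneg _) fun u => ?_
  rcases eq_or_ne (T u) 0 with h0 | h0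
  · rw [h0, norm_zero]; positivity
  have h := bound' u (T u)
  rw [inner_self_eq_norm_sq_to_K] at h
  refine le_of_mul_le_mul_right ?_ (norm_pos_iff.2 h0)
  simpa [sq] using h

omit [CompleteSpace K] in
/-- A bounded sequence of operators which converges on a total set converges pointwise. -/
theorem tendsto_of_tendsto_span {A : K →L[ℂ] K} {T : ℕ → K →L[ℂ] K} {C : ℝ}
    (hC : ∀ N, ‖T N‖ ≤ C) {s : Set K} (hs : Dense (Submodule.span ℂ s : Set K))
    (h : ∀ u ∈ s, Tendsto (fun N => T N u) atTop (𝓝 (A u))) (u : K) :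
    Tendsto (fun N => T N u) atTop (𝓝 (A u)) := by
  have hspan : ∀ u ∈ Submodule.span ℂ s, Tendsto (fun N => T N u) atTop (𝓝 (A u)) := by
    intro u hu
    induction hu using Submodule.span_induction with
    | mem u hu => exact h u hu
    | zero => simp
    | add u v _ _ hu hv => simpa using hu.add hv
    | smul c u _ hu => simpa using hu.const_smul c
  have hC0 : 0 ≤ C := (norm_nonneg _).trans (hC 0)
  rw [Metric.tendsto_atTop]
  intro ε hε
  -- The `+ 1` keeps the denominator positive when `C = ‖A‖ = 0`.
  obtain ⟨v, hv, huv⟩ := Metric.mem_closure_iff.1 (hs u) (ε / (2 * (C + ‖A‖ + 1)))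
    (by positivity)
  obtain ⟨N₀, hN₀⟩ := Metric.tendsto_atTop.1 (hspan v hv) (ε / 2) (by positivity)
  refine ⟨N₀, fun N hN => ?_⟩
  have h1 := hN₀ N hN
  rw [dist_eq_norm] at *
  have e : T N u - A u = T N (u - v) + (T N v - A v) - A (u - v) := by
    simp only [map_sub]; abel
  have h2 : ‖T N (u - v)‖ ≤ C * ‖u - v‖ := (T N).le_of_opNorm_le (hC N) _
  have h3 := A.le_opNorm (u - v)
  have h4 : (C + ‖A‖) * ‖u - v‖ ≤ ε / 2 := by
    calc (C + ‖A‖) * ‖u - v‖ ≤ (C + ‖A‖ + 1) * (ε / (2 * (C + ‖A‖ + 1))) := by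
          gcongr ?_ * ?_
          linarith
      _ = ε / 2 := by field_simp
  calc ‖T N u - A u‖ ≤ ‖T N (u - v)‖ + ‖T N v - A v‖ + ‖A (u - v)‖ := by
        rw [e]; exact (norm_sub_le _ _).trans (by gcongr; exact norm_add_le _ _)
    _ < ε := by linarith

/-- Entrywise multipliers with values in `[0, 1]` that tend to `1` converge strongly on each
summand. -/
theorem tendsto_of_multipliers (hV : IsHilbertSum ℂ (fun _ : ι => E) V) {A : K →L[ℂ] K}
    {T : ℕ → K →L[ℂ] K} {i : ι} (x : E) (c : ℕ → ι → ℝ) (h0 : ∀ N j, 0 ≤ c N j)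
    (h1 : ∀ N j, c N j ≤ 1) (hc : ∀ j, Tendsto (fun N => c N j) atTop (𝓝 1))
    (hT : ∀ N j, coord V j (T N (V i x)) = (c N j : ℂ) • coord V j (A (V i x))) :
    Tendsto (fun N => T N (V i x)) atTop (𝓝 (A (V i x))) := by
  have hn : ∀ N, ‖T N (V i x) - A (V i x)‖ ^ 2 =
      ∑' j, (c N j - 1) ^ 2 * ‖coord V j (A (V i x))‖ ^ 2 := fun N => by
    rw [← (hasSum_norm_coord_sq hV _).tsum_eq]
    refine tsum_congr fun j => ?_
    have : coord V j (T N (V i x) - A (V i x)) =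
        ((c N j - 1 : ℝ) : ℂ) • coord V j (A (V i x)) := by
      rw [map_sub, hT]; push_cast; rw [sub_smul, one_smul]
    rw [this, norm_smul, mul_pow, Complex.norm_real, Real.norm_eq_abs, sq_abs]
  have ht : Tendsto (fun N => ‖T N (V i x) - A (V i x)‖ ^ 2) atTop (𝓝 0) := by
    simp only [hn]
    -- The column of `A` at `V i x` is square summable and dominates, since `(c - 1)² ≤ 1`.
    have := tendsto_tsum_of_dominated_convergence (𝓕 := atTop)
      (f := fun N j => (c N j - 1) ^ 2 * ‖coord V j (A (V i x))‖ ^ 2) (g := fun _ => (0 : ℝ))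
      (bound := fun j => ‖coord V j (A (V i x))‖ ^ 2)
      (hasSum_norm_coord_sq hV _).summable (fun j => by
        simpa using (((hc j).sub_const 1).pow 2).mul_const (‖coord V j (A (V i x))‖ ^ 2))
      (Eventually.of_forall fun N j => by
        rw [Real.norm_of_nonneg (by positivity)]
        refine mul_le_of_le_one_left (by positivity) ?_
        have := h0 N j; have := h1 N j
        nlinarith)
    simpa using this
  rw [tendsto_iff_norm_sub_tendsto_zero]
  have := ht.sqrt
  simpa [Real.sqrt_sq (norm_nonneg _)] using this

end HilbertSum

/-! ### Operators on the Hilbert space tensor product -/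

section Tensor

variable {E F : Type*} [NormedAddCommGroup E] [InnerProductSpace ℂ E]
  [NormedAddCommGroup F] [InnerProductSpace ℂ F]

/-- The map `φ ↦ x ⊗ φ` into the Hilbert space tensor product. -/
def tensorLeft (F : Type*) [NormedAddCommGroup F] [InnerProductSpace ℂ F] (x : E) :
    F →L[ℂ] HilbertTensor E F :=
  UniformSpace.Completion.toComplL ∘L TensorProduct.mkL ℂ E F x

theorem tensorLeft_apply (x : E) (φ : F) :
    tensorLeft F x φ = ((x ⊗ₜ[ℂ] φ : E ⊗[ℂ] F) : HilbertTensor E F) := rfl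

theorem opTensor_tensorLeft (Y : E →L[ℂ] E) (T : F →L[ℂ] F) (x : E) (φ : F) :
    opTensor Y T (tensorLeft F x φ) = tensorLeft F (Y x) (T φ) := by
  rw [tensorLeft_apply, tensorLeft_apply, opTensor, ContinuousLinearMap.completion_apply_coe]
  simp

theorem inner_tensorLeft (x y : E) (φ ψ : F) :
    ⟪tensorLeft F x φ, tensorLeft F y ψ⟫_ℂ = ⟪x, y⟫_ℂ * ⟪φ, ψ⟫_ℂ := by
  rw [tensorLeft_apply, tensorLeft_apply, UniformSpace.Completion.inner_coe,
    TensorProduct.inner_tmul]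

theorem dense_span_tensorLeft :
    Dense (Submodule.span ℂ {u | ∃ (x : E) (φ : F), tensorLeft F x φ = u} :
      Set (HilbertTensor E F)) := by
  refine (UniformSpace.Completion.denseRange_coe (α := E ⊗[ℂ] F)).mono ?_
  rintro _ ⟨t, rfl⟩
  induction t with
  | zero => rw [UniformSpace.Completion.coe_zero]; exact Submodule.zero_mem _
  | tmul x φ => exact Submodule.subset_span ⟨x, φ, rfl⟩
  | add s t hs ht => rw [UniformSpace.Completion.coe_add]; exact Submodule.add_mem _ hs ht

theorem clm_ext_tensorLeft {G : Type*} [NormedAddCommGroup G] [NormedSpace ℂ G]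
    {S T : HilbertTensor E F →L[ℂ] G}
    (h : ∀ x φ, S (tensorLeft F x φ) = T (tensorLeft F x φ)) : S = T := by
  refine ContinuousLinearMap.ext_on dense_span_tensorLeft ?_
  rintro _ ⟨x, φ, rfl⟩
  exact h x φ

theorem opTensor_comp (Y Y' : E →L[ℂ] E) (T T' : F →L[ℂ] F) :
    opTensor Y T ∘L opTensor Y' T' = opTensor (Y ∘L Y') (T ∘L T') :=
  clm_ext_tensorLeft fun x φ => by simp [opTensor_tensorLeft]

theorem opTensor_zero_right (Y : E →L[ℂ] E) : opTensor Y (0 : F →L[ℂ] F) = 0 :=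
  clm_ext_tensorLeft fun x φ => by simp [opTensor_tensorLeft]

theorem adjoint_opTensor [CompleteSpace E] [CompleteSpace F] (Y : E →L[ℂ] E) (T : F →L[ℂ] F) :
    ContinuousLinearMap.adjoint (opTensor Y T) =
      opTensor (ContinuousLinearMap.adjoint Y) (ContinuousLinearMap.adjoint T) := by
  refine clm_ext_tensorLeft fun x φ => ?_
  refine dense_span_tensorLeft.eq_of_inner_left (𝕜 := ℂ) fun v hv => ?_
  induction hv using Submodule.span_induction with
  | zero => simp
  | add u v _ _ hu hv => rw [inner_add_right, inner_add_right, hu, hv]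
  | smul c u _ hu => rw [inner_smul_right, inner_smul_right, hu]
  | mem u hu =>
    obtain ⟨y, ψ, rfl⟩ := hu
    rw [ContinuousLinearMap.adjoint_inner_left, opTensor_tensorLeft, opTensor_tensorLeft,
      inner_tensorLeft, inner_tensorLeft, ContinuousLinearMap.adjoint_inner_left,
      ContinuousLinearMap.adjoint_inner_left]

end Tensor

/-! ### Decomposition of `E ⊗ F²(H_n)` along words -/

section Word

variable {n : ℕ} {E : Type*} [NormedAddCommGroup E] [InnerProductSpace ℂ E]

theorem inner_fockBasis [DecidableEq (FreeMonoid (Fin n))] (α β : FreeMonoid (Fin n)) :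
    ⟪fockBasis n α, fockBasis n β⟫_ℂ = if α = β then 1 else 0 :=
  orthonormal_iff_ite.1 (fockBasis n).orthonormal α β

/-- The isometry `x ↦ x ⊗ e_α`. -/
def wordEmbedding (E : Type*) [NormedAddCommGroup E] [InnerProductSpace ℂ E]
    (α : FreeMonoid (Fin n)) : E →ₗᵢ[ℂ] HilbertTensor E (Fock n) where
  toFun x := tensorLeft (Fock n) x (fockBasis n α)
  map_add' x y := by
    simp only [tensorLeft_apply, TensorProduct.add_tmul, UniformSpace.Completion.coe_add]
  map_smul' c x := by
    simp only [tensorLeft_apply, ← TensorProduct.smul_tmul', UniformSpace.Completion.coe_smul,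
      RingHom.id_apply]
  norm_map' x := by
    change ‖tensorLeft (Fock n) x (fockBasis n α)‖ = ‖x‖
    rw [tensorLeft_apply, UniformSpace.Completion.norm_coe, TensorProduct.norm_tmul,
      (fockBasis n).orthonormal.1, mul_one]

theorem wordEmbedding_apply (α : FreeMonoid (Fin n)) (x : E) :
    wordEmbedding E α x = tensorLeft (Fock n) x (fockBasis n α) := rfl

theorem orthogonalFamily_wordEmbedding :
    OrthogonalFamily ℂ (fun _ : FreeMonoid (Fin n) => E) (wordEmbedding E) := by
  classical
  intro α β h x y
  rw [wordEmbedding_apply, wordEmbedding_apply, inner_tensorLeft, inner_fockBasis, if_neg h,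
    mul_zero]

/-- Expanding `φ` in the word basis exhibits `x ⊗ φ` as a limit of finite sums of vectors `x ⊗ e_α`,
and the elementary tensors are total. -/
theorem isHilbertSum_wordEmbedding [CompleteSpace E] :
    IsHilbertSum ℂ (fun _ : FreeMonoid (Fin n) => E) (wordEmbedding E) := by
  refine IsHilbertSum.mk orthogonalFamily_wordEmbedding fun u _ => ?_
  refine closure_minimal (s := (Submodule.span ℂ {u | ∃ (x : E) (φ : Fock n),
    tensorLeft (Fock n) x φ = u} : Set _)) ?_ (Submodule.isClosed_topologicalClosure _)
    (dense_span_tensorLeft u)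
  refine SetLike.coe_subset_coe.2 (Submodule.span_le.2 ?_)
  rintro _ ⟨x, φ, rfl⟩
  refine mem_closure_of_tendsto (((fockBasis n).hasSum_repr φ).mapL (tensorLeft (Fock n) x))
    (Eventually.of_forall fun s => Submodule.sum_mem _ fun α _ => ?_)
  rw [map_smul]
  exact Submodule.smul_mem _ _ (Submodule.mem_iSup_of_mem α ⟨x, rfl⟩)

theorem coord_wordEmbedding_tensorLeft [CompleteSpace E] (α : FreeMonoid (Fin n)) (x : E)
    (φ : Fock n) :
    coord (wordEmbedding E) α (tensorLeft (Fock n) x φ) = ⟪fockBasis n α, φ⟫_ℂ • x :=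
  ext_inner_left ℂ fun y => by
    rw [inner_coord_right, wordEmbedding_apply, inner_tensorLeft, inner_smul_right, mul_comm]

end Word

/-! ### Relations between left and right creation operators -/

section Creation

variable {n : ℕ}

theorem fock_clm_ext {S T : Fock n →L[ℂ] Fock n}
    (h : ∀ α, S (fockBasis n α) = T (fockBasis n α)) : S = T := by
  refine ContinuousLinearMap.ext_on (s := Set.range (fockBasis n)) ?_ ?_
  · exact Submodule.dense_iff_topologicalClosure_eq_top.2 (fockBasis n).dense_span
  · rintro _ ⟨α, rfl⟩
    exact h α

theorem mul_of_eq_mul_of_iff {α β : FreeMonoid (Fin n)} {i j : Fin n} :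
    α * FreeMonoid.of i = β * FreeMonoid.of j ↔ α = β ∧ i = j := by
  refine ⟨fun h => ?_, fun h => by rw [h.1, h.2]⟩
  have h' := List.append_inj' (congrArg FreeMonoid.toList h) rfl
  exact ⟨h'.1, List.singleton_inj.1 h'.2⟩

theorem adjoint_rightCreation_comp (i j : Fin n) :
    ContinuousLinearMap.adjoint (rightCreation i) ∘L rightCreation j =
      if i = j then ContinuousLinearMap.id ℂ (Fock n) else 0 := by
  classical
  refine fock_clm_ext fun α => (fockBasis n).repr.injective (lp.ext (funext fun γ => ?_))
  rw [HilbertBasis.repr_apply_apply, HilbertBasis.repr_apply_apply,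
    ContinuousLinearMap.comp_apply, ContinuousLinearMap.adjoint_inner_right,
    rightCreation_basis, rightCreation_basis, inner_fockBasis]
  by_cases hij : i = j
  · simp [hij, inner_fockBasis]
  · simp [hij, mul_of_eq_mul_of_iff]

/-- Prepending and appending letters commute by associativity; the centralizer of `R_j` is a norm
closed algebra, so it contains all of `𝒜_n`. -/
theorem comp_rightCreation_of_mem_discAlgebra {T : Fock n →L[ℂ] Fock n} (hT : T ∈ discAlgebra n)
    (j : Fin n) : T ∘L rightCreation j = rightCreation j ∘L T := by
  have h : discAlgebra n ≤ Subalgebra.centralizer ℂ {rightCreation j} := by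
    refine Subalgebra.topologicalClosure_minimal ?_ (Set.isClosed_centralizer _)
    refine Algebra.adjoin_le ?_
    rintro _ ⟨i, rfl⟩
    refine Subalgebra.mem_centralizer_iff ℂ |>.2 ?_
    rintro _ rfl
    refine fock_clm_ext fun α => ?_
    change rightCreation j (leftCreation i _) = leftCreation i (rightCreation j _)
    simp only [leftCreation_basis, rightCreation_basis, mul_assoc]
  exact ((Subalgebra.mem_centralizer_iff ℂ).1 (h hT) _ rfl).symm

/-- The isometry `S_α`, `e_β ↦ e_{αβ}`. -/
def wordCreation (α : FreeMonoid (Fin n)) : Fock n →L[ℂ] Fock n :=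
  (fockIsometry (fun β => α * β) (fun _ _ h => mul_left_cancel h)).toContinuousLinearMap

theorem wordCreation_basis (α β : FreeMonoid (Fin n)) :
    wordCreation α (fockBasis n β) = fockBasis n (α * β) :=
  fockIsometry_basis _ (fun _ _ h => mul_left_cancel h) β

theorem wordCreation_mem_discAlgebra (α : FreeMonoid (Fin n)) :
    wordCreation α ∈ discAlgebra n := by
  refine Subalgebra.le_topologicalClosure _ ?_
  induction α using FreeMonoid.inductionOn' with
  | one =>
    convert Subalgebra.one_mem _
    exact fock_clm_ext fun β => by rw [wordCreation_basis, one_mul]; rfl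
  | of_mul i α h =>
    have e : wordCreation (FreeMonoid.of i * α) = leftCreation i * wordCreation α :=
      fock_clm_ext fun β => by
        change _ = leftCreation i (wordCreation α _)
        rw [wordCreation_basis, wordCreation_basis, leftCreation_basis, mul_assoc]
    rw [e]
    exact Subalgebra.mul_mem _ (Algebra.subset_adjoin ⟨i, rfl⟩) h

end Creation

/-! ### The operator system and its WOT closure are multi-Toeplitz -/

section MultiToeplitz

variable {n : ℕ} {E : Type*} [NormedAddCommGroup E] [InnerProductSpace ℂ E] [CompleteSpace E]

/-- Scalar equations in matrix coefficients pass readily to linear combinations, adjoints, and norm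
or weak limits. -/
theorem isMultiToeplitz_iff_inner {A : HilbertTensor E (Fock n) →L[ℂ] HilbertTensor E (Fock n)} :
    IsMultiToeplitz n E A ↔ ∀ (i j : Fin n) (v u : HilbertTensor E (Fock n)),
      ⟪opTensor (ContinuousLinearMap.id ℂ E) (rightCreation i) v,
        A (opTensor (ContinuousLinearMap.id ℂ E) (rightCreation j) u)⟫_ℂ =
      if i = j then ⟪v, A u⟫_ℂ else 0 := by
  have e : ∀ i : Fin n, opTensor (ContinuousLinearMap.id ℂ E)
      (ContinuousLinearMap.adjoint (rightCreation i)) = ContinuousLinearMap.adjoint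
        (opTensor (ContinuousLinearMap.id ℂ E) (rightCreation i)) := fun i => by
    rw [adjoint_opTensor, ContinuousLinearMap.adjoint_id]
  refine forall₂_congr fun i j => ?_
  rw [e]
  constructor
  · intro h v u
    rw [← ContinuousLinearMap.adjoint_inner_right]
    refine (congrArg (fun T : _ →L[ℂ] _ => ⟪v, T u⟫_ℂ) h).trans ?_
    split_ifs <;> simp
  · intro h
    refine ContinuousLinearMap.ext fun u => ext_inner_left ℂ fun v => ?_
    rw [ContinuousLinearMap.comp_apply, ContinuousLinearMap.comp_apply,
      ContinuousLinearMap.adjoint_inner_right, h]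
    split_ifs <;> simp

variable (n E) in
/-- The multi-Toeplitz operators, as a linear subspace. -/
def multiToeplitz : Submodule ℂ (HilbertTensor E (Fock n) →L[ℂ] HilbertTensor E (Fock n)) where
  carrier := {A | IsMultiToeplitz n E A}
  zero_mem' := isMultiToeplitz_iff_inner.2 fun i j v u => by simp
  add_mem' {A B} hA hB := isMultiToeplitz_iff_inner.2 fun i j v u => by
    have h1 := isMultiToeplitz_iff_inner.1 hA i j v u
    have h2 := isMultiToeplitz_iff_inner.1 hB i j v u
    simp only [add_apply, inner_add_right, h1, h2]
    split_ifs <;> simp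
  smul_mem' c A hA := isMultiToeplitz_iff_inner.2 fun i j v u => by
    have h1 := isMultiToeplitz_iff_inner.1 hA i j v u
    simp only [smul_apply, inner_smul_right, h1]
    split_ifs <;> simp

theorem mem_multiToeplitz {A : HilbertTensor E (Fock n) →L[ℂ] HilbertTensor E (Fock n)} :
    A ∈ multiToeplitz n E ↔ IsMultiToeplitz n E A := Iff.rfl

theorem isMultiToeplitz_adjoint {A : HilbertTensor E (Fock n) →L[ℂ] HilbertTensor E (Fock n)}
    (hA : IsMultiToeplitz n E A) : IsMultiToeplitz n E (ContinuousLinearMap.adjoint A) :=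
  isMultiToeplitz_iff_inner.2 fun i j v u => by
    rw [ContinuousLinearMap.adjoint_inner_right, ← inner_conj_symm,
      isMultiToeplitz_iff_inner.1 hA j i u v, ContinuousLinearMap.adjoint_inner_right]
    by_cases h : i = j
    · simp [h]
    · simp [h, Ne.symm h]

-- Moving `R_j` to the left of `T` leaves `R_i^* R_j = δ_{ij}`.
omit [CompleteSpace E] in
theorem isMultiToeplitz_opTensor (Y : E →L[ℂ] E) {T : Fock n →L[ℂ] Fock n}
    (hT : T ∈ discAlgebra n) : IsMultiToeplitz n E (opTensor Y T) := fun i j => by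
  rw [opTensor_comp, opTensor_comp, comp_rightCreation_of_mem_discAlgebra hT,
    ← ContinuousLinearMap.comp_assoc (ContinuousLinearMap.adjoint _), adjoint_rightCreation_comp]
  split_ifs
  · simp
  · simp [opTensor_zero_right]

theorem isClosed_multiToeplitz :
    IsClosed (multiToeplitz n E :
      Set (HilbertTensor E (Fock n) →L[ℂ] HilbertTensor E (Fock n))) := by
  have : (multiToeplitz n E :
      Set (HilbertTensor E (Fock n) →L[ℂ] HilbertTensor E (Fock n))) = ⋂ (i : Fin n) (j : Fin n)
      (v : HilbertTensor E (Fock n)) (u : HilbertTensor E (Fock n)), {A |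
      ⟪opTensor (ContinuousLinearMap.id ℂ E) (rightCreation i) v,
        A (opTensor (ContinuousLinearMap.id ℂ E) (rightCreation j) u)⟫_ℂ =
      if i = j then ⟪v, A u⟫_ℂ else 0} := by
    ext A
    simp only [SetLike.mem_coe, mem_multiToeplitz, isMultiToeplitz_iff_inner, Set.mem_iInter,
      Set.mem_ofPred_eq]
  rw [this]
  refine isClosed_iInter fun i => isClosed_iInter fun j => isClosed_iInter fun v =>
    isClosed_iInter fun u => isClosed_eq (by fun_prop) ?_
  split_ifs <;> fun_prop

theorem discAlgebraTensor_le_multiToeplitz : discAlgebraTensor n E ≤ multiToeplitz n E := by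
  refine Submodule.topologicalClosure_minimal _ (Submodule.span_le.2 ?_) isClosed_multiToeplitz
  rintro _ ⟨Y, T, hT, rfl⟩
  exact isMultiToeplitz_opTensor Y hT

theorem discOperatorSystem_subset_multiToeplitz :
    discOperatorSystem n E ⊆ {A | IsMultiToeplitz n E A} := by
  rintro _ ⟨P, hP, Q, hQ, rfl⟩
  exact (multiToeplitz n E).add_mem
    (isMultiToeplitz_adjoint (discAlgebraTensor_le_multiToeplitz hP))
    (discAlgebraTensor_le_multiToeplitz hQ)

/-- Each matrix coefficient is a WOT continuous functional, so every scalar equation defines a WOT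
closed set. -/
theorem wotClosure_discOperatorSystem_subset :
    wotClosure (discOperatorSystem n E) ⊆ {A | IsMultiToeplitz n E A} := by
  intro A hA
  refine isMultiToeplitz_iff_inner.2 fun i j v u => ?_
  have hc : ∀ v u : HilbertTensor E (Fock n), Continuous
      fun B : HilbertTensor E (Fock n) →WOT[ℂ] HilbertTensor E (Fock n) => ⟪v, B u⟫_ℂ :=
    fun v u => ContinuousLinearMapWOT.continuous_dual_apply u (innerSL ℂ v)
  have hcl : IsClosed {B : HilbertTensor E (Fock n) →WOT[ℂ] HilbertTensor E (Fock n) |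
      ⟪opTensor (ContinuousLinearMap.id ℂ E) (rightCreation i) v,
        B (opTensor (ContinuousLinearMap.id ℂ E) (rightCreation j) u)⟫_ℂ =
      if i = j then ⟪v, B u⟫_ℂ else 0} := by
    refine isClosed_eq (hc _ _) ?_
    split_ifs
    · exact hc _ _
    · exact continuous_const
  refine closure_minimal ?_ hcl hA
  rintro _ ⟨B, hB, rfl⟩
  exact isMultiToeplitz_iff_inner.1 (discOperatorSystem_subset_multiToeplitz hB) i j v u

end MultiToeplitz

/-! ### Strong and weak operator closures -/

theorem sotClosure_subset_wotClosure {K : Type*} [NormedAddCommGroup K] [InnerProductSpace ℂ K]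
    (M : Set (K →L[ℂ] K)) : sotClosure M ⊆ wotClosure M := by
  intro A hA
  let f : PointwiseConvergenceCLM (RingHom.id ℂ) K K → (K →WOT[ℂ] K) :=
    fun B => ContinuousLinearMapWOT.ofCLM (show K →L[ℂ] K from B)
  have hf : Continuous f := ContinuousLinearMapWOT.continuous_of_dual_apply_continuous fun x y =>
    y.continuous.comp (PointwiseConvergenceCLM.evalCLM (RingHom.id ℂ) K x).continuous
  have h := image_closure_subset_closure_image hf (Set.mem_image_of_mem f hA)
  rwa [Set.image_image] at h

theorem mem_sotClosure_of_tendsto {K : Type*} [NormedAddCommGroup K] [InnerProductSpace ℂ K]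
    {M : Set (K →L[ℂ] K)} {A : K →L[ℂ] K} {T : ℕ → K →L[ℂ] K} (hT : ∀ N, T N ∈ M)
    (h : ∀ u, Tendsto (fun N => T N u) atTop (𝓝 (A u))) : A ∈ sotClosure M := by
  have h' : Tendsto (fun N => ContinuousLinearMap.toPointwiseConvergenceCLM ℂ (RingHom.id ℂ) K K
      (T N)) atTop (𝓝 (ContinuousLinearMap.toPointwiseConvergenceCLM ℂ (RingHom.id ℂ) K K A)) :=
    PointwiseConvergenceCLM.tendsto_iff_forall_tendsto.2 h
  change ContinuousLinearMap.toPointwiseConvergenceCLM ℂ (RingHom.id ℂ) K K A ∈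
    closure (ContinuousLinearMap.toPointwiseConvergenceCLM ℂ (RingHom.id ℂ) K K '' M)
  exact mem_closure_of_tendsto h' (Eventually.of_forall fun N => Set.mem_image_of_mem _ (hT N))

/-! ### Fejér means of a multi-Toeplitz operator -/

section Fejer

variable {n : ℕ} {E : Type*} [NormedAddCommGroup E] [InnerProductSpace ℂ E] [CompleteSpace E]

/-- Two words are comparable in the suffix order, or differ to the left of a common suffix. -/
theorem suffix_trichotomy (β γ : FreeMonoid (Fin n)) :
    (∃ α, γ = α * β) ∨ (∃ α, α ≠ 1 ∧ β = α * γ) ∨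
      ∃ (i j : Fin n) (β' γ' δ : FreeMonoid (Fin n)), i ≠ j ∧
        β = β' * FreeMonoid.of i * δ ∧ γ = γ' * FreeMonoid.of j * δ := by
  have last : ∀ δ : FreeMonoid (Fin n), δ = 1 ∨ ∃ δ' i, δ = δ' * FreeMonoid.of i := fun δ => by
    rcases List.eq_nil_or_concat (FreeMonoid.toList δ) with h | ⟨l, i, h⟩
    · exact Or.inl h
    · exact Or.inr ⟨FreeMonoid.ofList l, i, h.trans (List.concat_eq_append ..)⟩
  -- Strip equal last letters until a word is exhausted or the last letters differ.
  induction h : β.length generalizing β γ with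
  | zero =>
    rw [FreeMonoid.length_eq_zero] at h
    exact Or.inl ⟨γ, by rw [h, mul_one]⟩
  | succ k ih =>
    obtain rfl | ⟨β', i, rfl⟩ := last β
    · simp at h
    obtain rfl | ⟨γ', j, rfl⟩ := last γ
    · refine Or.inr (Or.inl ⟨β' * FreeMonoid.of i, fun h0 => ?_, (mul_one _).symm⟩)
      rw [h0] at h
      simp at h
    by_cases hij : i = j
    · subst hij
      rcases ih β' γ' (by simpa using h) with ⟨α, rfl⟩ | ⟨α, hα, rfl⟩ |
        ⟨i', j', β'', γ'', δ, hij, rfl, rfl⟩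
      · exact Or.inl ⟨α, mul_assoc _ _ _⟩
      · exact Or.inr (Or.inl ⟨α, hα, mul_assoc _ _ _⟩)
      · exact Or.inr (Or.inr ⟨i', j', β'', γ'', δ * FreeMonoid.of i, hij, by simp only [mul_assoc],
          by simp only [mul_assoc]⟩)
    · exact Or.inr (Or.inr ⟨i, j, β', γ', 1, hij, by rw [mul_one], by rw [mul_one]⟩)

theorem coord_mul_of {A : HilbertTensor E (Fock n) →L[ℂ] HilbertTensor E (Fock n)}
    (hA : IsMultiToeplitz n E A) (β γ : FreeMonoid (Fin n)) (i j : Fin n) (x : E) :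
    coord (wordEmbedding E) (γ * FreeMonoid.of i)
        (A (wordEmbedding E (β * FreeMonoid.of j) x)) =
      if i = j then coord (wordEmbedding E) γ (A (wordEmbedding E β x)) else 0 := by
  have hR : ∀ (α : FreeMonoid (Fin n)) (i : Fin n) (y : E),
      wordEmbedding E (α * FreeMonoid.of i) y =
        opTensor (ContinuousLinearMap.id ℂ E) (rightCreation i) (wordEmbedding E α y) :=
    fun α i y => by
      rw [wordEmbedding_apply, wordEmbedding_apply, opTensor_tensorLeft, rightCreation_basis]; rfl
  refine ext_inner_left ℂ fun y => ?_
  rw [inner_coord_right, hR, hR, isMultiToeplitz_iff_inner.1 hA]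
  split_ifs
  · rw [inner_coord_right]
  · rw [inner_zero_right]

/-- Entries are constant along common suffixes, so for comparable words they reduce to the first row
or column. -/
theorem coord_mul_mul {A : HilbertTensor E (Fock n) →L[ℂ] HilbertTensor E (Fock n)}
    (hA : IsMultiToeplitz n E A) (β γ δ : FreeMonoid (Fin n)) (x : E) :
    coord (wordEmbedding E) (γ * δ) (A (wordEmbedding E (β * δ) x)) =
      coord (wordEmbedding E) γ (A (wordEmbedding E β x)) := by
  induction δ using FreeMonoid.inductionOn' generalizing β γ with
  | one => rw [mul_one, mul_one]
  | of_mul i δ h => rw [← mul_assoc, ← mul_assoc, h, coord_mul_of hA, if_pos rfl]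

theorem finite_setOf_length_lt (n N : ℕ) :
    {α : FreeMonoid (Fin n) | α.length < N}.Finite :=
  List.finite_length_lt (Fin n) N

/-- The words of length less than `N`. -/
def shortWords (n N : ℕ) : Finset (FreeMonoid (Fin n)) := (finite_setOf_length_lt n N).toFinset

theorem mem_shortWords {N : ℕ} {α : FreeMonoid (Fin n)} : α ∈ shortWords n N ↔ α.length < N := by
  simp [shortWords]

/-- The words `α` with `m - N < |α| ≤ m`. -/
def windowWords (n N m : ℕ) : Finset (FreeMonoid (Fin n)) :=
  (shortWords n (m + 1)).filter fun α => m < α.length + N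

theorem mem_windowWords {N m : ℕ} {α : FreeMonoid (Fin n)} :
    α ∈ windowWords n N m ↔ α.length ≤ m ∧ m < α.length + N := by
  simp [windowWords, mem_shortWords]

/-- The Fejér weight `(1 - |a - b| / N)⁺`. -/
def fejerWeight (N a b : ℕ) : ℝ := ((min a b + N - max a b : ℕ) : ℝ) / N

theorem fejerWeight_nonneg (N a b : ℕ) : 0 ≤ fejerWeight N a b := by
  unfold fejerWeight; positivity

theorem fejerWeight_le_one (N a b : ℕ) : fejerWeight N a b ≤ 1 :=
  div_le_one_of_le₀ (by exact_mod_cast (by omega : min a b + N - max a b ≤ N)) (by positivity)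

theorem fejerWeight_comm (N a b : ℕ) : fejerWeight N a b = fejerWeight N b a := by
  rw [fejerWeight, fejerWeight, min_comm, max_comm]

theorem fejerWeight_add (N a b : ℕ) : fejerWeight N b (a + b) = fejerWeight N 0 a := by
  rw [fejerWeight, fejerWeight]
  congr 2
  omega

theorem fejerWeight_eq_zero {N a : ℕ} (h : N ≤ a) : fejerWeight N 0 a = 0 := by
  rw [fejerWeight, show min 0 a + N - max 0 a = 0 by omega, Nat.cast_zero, zero_div]

theorem tendsto_fejerWeight (a b : ℕ) :
    Tendsto (fun N => fejerWeight N a b) atTop (𝓝 1) := by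
  have h : Tendsto (fun N : ℕ => 1 + ((min a b : ℝ) - max a b) / N) atTop (𝓝 (1 + 0)) :=
    (tendsto_const_div_atTop_nhds_zero_nat _).const_add 1
  rw [add_zero] at h
  refine h.congr' ?_
  filter_upwards [eventually_ge_atTop (max a b + 1)] with N hN
  have h0 : (N : ℝ) ≠ 0 := by exact_mod_cast (by omega : N ≠ 0)
  rw [fejerWeight, Nat.cast_sub (by omega)]
  push_cast
  field_simp
  ring

theorem card_windows_le [DecidableEq (FreeMonoid (Fin n))] (N : ℕ) (β : FreeMonoid (Fin n)) (M : ℕ) :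
    ((Finset.range M).filter fun m => β ∈ windowWords n N m).card ≤ N := by
  calc _ ≤ (Finset.Ico β.length (β.length + N)).card := by
        refine Finset.card_le_card fun m hm => ?_
        simpa using mem_windowWords.1 (Finset.mem_filter.1 hm).2
    _ = N := by simp

/-- The common windows are those with `max ≤ m < min + N`. Truncated subtraction supplies the
positive part, so the count is `N` times the Fejér weight. -/
theorem card_windows_eq [DecidableEq (FreeMonoid (Fin n))] {N M : ℕ} (β γ : FreeMonoid (Fin n)) (hM : β.length + N ≤ M) :
    ((Finset.range M).filter fun m => β ∈ windowWords n N m ∧ γ ∈ windowWords n N m).card =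
      min β.length γ.length + N - max β.length γ.length := by
  rw [← Nat.card_Ico]
  congr 1
  refine Finset.ext fun m => ?_
  simp only [Finset.mem_filter, Finset.mem_range, mem_windowWords, Finset.mem_Ico]
  omega

variable (A : HilbertTensor E (Fock n) →L[ℂ] HilbertTensor E (Fock n)) (N : ℕ)

/-- The coefficient `A_{γ,β} ∈ B(E)` of an operator on `E ⊗ F²(H_n)`. -/
def blockEntry (γ β : FreeMonoid (Fin n)) : E →L[ℂ] E :=
  coord (wordEmbedding E) γ ∘L A ∘L (wordEmbedding E β).toContinuousLinearMap

theorem blockEntry_apply (γ β : FreeMonoid (Fin n)) (x : E) :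
    blockEntry A γ β x = coord (wordEmbedding E) γ (A (wordEmbedding E β x)) := rfl

/-- The analytic part of the `N`-th Fejér mean of a multi-Toeplitz operator. -/
def fejerAnalytic : HilbertTensor E (Fock n) →L[ℂ] HilbertTensor E (Fock n) :=
  ∑ α ∈ shortWords n N, ((fejerWeight N 0 α.length : ℝ) : ℂ) •
    opTensor (blockEntry A α 1) (wordCreation α)

/-- The adjoint of the strictly coanalytic part of the `N`-th Fejér mean. -/
def fejerCoanalytic : HilbertTensor E (Fock n) →L[ℂ] HilbertTensor E (Fock n) :=
  -- The empty word is left out, as the analytic part already carries the diagonal.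
  ∑ α ∈ (shortWords n N).filter (0 < ·.length), ((fejerWeight N 0 α.length : ℝ) : ℂ) •
    opTensor (ContinuousLinearMap.adjoint (blockEntry A 1 α)) (wordCreation α)

/-- The `N`-th Fejér mean of a multi-Toeplitz operator. -/
def fejerMean : HilbertTensor E (Fock n) →L[ℂ] HilbertTensor E (Fock n) :=
  ContinuousLinearMap.adjoint (fejerCoanalytic A N) + fejerAnalytic A N

omit [CompleteSpace E] in
theorem opTensor_wordCreation_mem (Y : E →L[ℂ] E) (α : FreeMonoid (Fin n)) :
    opTensor Y (wordCreation α) ∈ discAlgebraTensor n E :=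
  Submodule.le_topologicalClosure _
    (Submodule.subset_span ⟨Y, _, wordCreation_mem_discAlgebra α, rfl⟩)

theorem fejerMean_mem_discOperatorSystem : fejerMean A N ∈ discOperatorSystem n E :=
  ⟨_, Submodule.sum_mem _ fun _ _ => Submodule.smul_mem _ _ (opTensor_wordCreation_mem _ _),
    _, Submodule.sum_mem _ fun _ _ => Submodule.smul_mem _ _ (opTensor_wordCreation_mem _ _), rfl⟩

theorem coord_opTensor_wordCreation [DecidableEq (FreeMonoid (Fin n))] (Y : E →L[ℂ] E)
    (α β γ : FreeMonoid (Fin n)) (x : E) :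
    coord (wordEmbedding E) γ (opTensor Y (wordCreation α) (wordEmbedding E β x)) =
      if γ = α * β then Y x else 0 := by
  rw [wordEmbedding_apply, opTensor_tensorLeft, wordCreation_basis, coord_wordEmbedding_tensorLeft,
    inner_fockBasis]
  split_ifs <;> simp

theorem coord_adjoint_opTensor_wordCreation [DecidableEq (FreeMonoid (Fin n))] (Y : E →L[ℂ] E)
    (α β γ : FreeMonoid (Fin n)) (x : E) :
    coord (wordEmbedding E) γ
        (ContinuousLinearMap.adjoint (opTensor (ContinuousLinearMap.adjoint Y) (wordCreation α))
          (wordEmbedding E β x)) = if β = α * γ then Y x else 0 := by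
  refine ext_inner_left ℂ fun y => ?_
  rw [inner_coord_right, ContinuousLinearMap.adjoint_inner_right, ← inner_coord_left,
    coord_opTensor_wordCreation]
  split_ifs
  · rw [ContinuousLinearMap.adjoint_inner_left]
  · rw [inner_zero_left, inner_zero_right]

theorem coord_fejerAnalytic [DecidableEq (FreeMonoid (Fin n))] (β γ : FreeMonoid (Fin n)) (x : E) :
    coord (wordEmbedding E) γ (fejerAnalytic A N (wordEmbedding E β x)) =
      ∑ α ∈ shortWords n N, if γ = α * β then
        ((fejerWeight N 0 α.length : ℝ) : ℂ) • blockEntry A α 1 x else 0 := by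
  simp only [fejerAnalytic, sum_apply, smul_apply, map_sum, map_smul,
    coord_opTensor_wordCreation, smul_ite, smul_zero]

theorem coord_adjoint_fejerCoanalytic [DecidableEq (FreeMonoid (Fin n))]
    (β γ : FreeMonoid (Fin n)) (x : E) :
    coord (wordEmbedding E) γ
        (ContinuousLinearMap.adjoint (fejerCoanalytic A N) (wordEmbedding E β x)) =
      ∑ α ∈ (shortWords n N).filter (0 < ·.length), if β = α * γ then
        ((fejerWeight N 0 α.length : ℝ) : ℂ) • blockEntry A 1 α x else 0 := by
  simp only [fejerCoanalytic, map_sum, map_smulₛₗ, Complex.conj_ofReal,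
    sum_apply, smul_apply, RingHom.id_apply,
    coord_adjoint_opTensor_wordCreation, smul_ite, smul_zero]

-- At most one term of the two sums meets a given entry: an analytic one if `β` is a suffix of `γ`,
-- a coanalytic one if `γ` is a proper suffix of `β`. For incomparable words no term does, and the
-- entry of `A` vanishes too.
variable {A} in
theorem coord_fejerMean (hA : IsMultiToeplitz n E A) (β γ : FreeMonoid (Fin n)) (x : E) :
    coord (wordEmbedding E) γ (fejerMean A N (wordEmbedding E β x)) =
      ((fejerWeight N β.length γ.length : ℝ) : ℂ) •
        coord (wordEmbedding E) γ (A (wordEmbedding E β x)) := by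
  classical
  rw [fejerMean, add_apply, map_add, coord_fejerAnalytic, coord_adjoint_fejerCoanalytic]
  rcases suffix_trichotomy β γ with ⟨α, rfl⟩ | ⟨α, hα, rfl⟩ | ⟨i, j, β', γ', δ, hij, rfl, rfl⟩
  -- A coanalytic term would need `β = α' * (α * β)` with `α'` nonempty, which lengths forbid.
  · rw [Finset.sum_eq_zero fun α' hα' => if_neg fun h => ?_, zero_add]
    · simp only [mul_left_inj, Finset.sum_ite_eq]
      have h := coord_mul_mul hA 1 α β x
      rw [one_mul] at h
      rw [h, FreeMonoid.length_mul, fejerWeight_add, blockEntry_apply]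
      split_ifs with hm
      · rfl
      -- Words of length at least `N` are missing from the sum, but their weight is zero.
      · rw [fejerWeight_eq_zero (not_lt.1 fun h => hm (mem_shortWords.2 h)), Complex.ofReal_zero,
          zero_smul]
    · have h' := congrArg FreeMonoid.length h
      simp only [FreeMonoid.length_mul] at h'
      have := (Finset.mem_filter.1 hα').2
      omega
  · have hl : 0 < α.length := Nat.pos_of_ne_zero fun h => hα (FreeMonoid.length_eq_zero.1 h)
    rw [Finset.sum_eq_zero (s := shortWords n N) fun α' hα' => if_neg fun h => ?_, add_zero]
    · simp only [mul_left_inj, Finset.sum_ite_eq]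
      have h := coord_mul_mul hA α 1 γ x
      rw [one_mul] at h
      rw [h, FreeMonoid.length_mul, fejerWeight_comm N (_ + _), fejerWeight_add, blockEntry_apply]
      split_ifs with hm
      · rfl
      · rw [fejerWeight_eq_zero (not_lt.1 fun h => hm (Finset.mem_filter.2
          ⟨mem_shortWords.2 h, hl⟩)), Complex.ofReal_zero, zero_smul]
    · have h' := congrArg FreeMonoid.length h
      simp only [FreeMonoid.length_mul] at h'
      omega
  · rw [coord_mul_mul hA, coord_mul_of hA, if_neg (Ne.symm hij), smul_zero,
      Finset.sum_eq_zero fun α _ => if_neg fun h => ?_,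
      Finset.sum_eq_zero fun α _ => if_neg fun h => ?_, add_zero]
    · rw [← mul_assoc, mul_left_inj, ← mul_assoc, mul_of_eq_mul_of_iff] at h
      exact hij h.2.symm
    · rw [← mul_assoc, mul_left_inj, ← mul_assoc, mul_of_eq_mul_of_iff] at h
      exact hij h.2

variable {A N} in
theorem norm_fejerMean_le (hA : IsMultiToeplitz n E A) (hN : 0 < N) : ‖fejerMean A N‖ ≤ ‖A‖ := by
  classical
  refine opNorm_le_of_window_average isHilbertSum_wordEmbedding (windowWords n N) hN
    (card_windows_le N) A _ fun β γ x => ?_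
  filter_upwards [eventually_ge_atTop (β.length + N)] with M hM
  have h0 : (N : ℂ) ≠ 0 := by exact_mod_cast hN.ne'
  rw [coord_fejerMean N hA, card_windows_eq β γ hM, smul_smul, fejerWeight]
  push_cast
  rw [mul_div_cancel₀ _ h0]

variable {A} in
theorem mem_sotClosure_of_isMultiToeplitz (hA : IsMultiToeplitz n E A) :
    A ∈ sotClosure (discOperatorSystem n E) := by
  -- The shift by one avoids `N = 0`, where the window average is undefined.
  refine mem_sotClosure_of_tendsto (T := fun N => fejerMean A (N + 1))
    (fun N => fejerMean_mem_discOperatorSystem A _) ?_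
  refine tendsto_of_tendsto_span (C := ‖A‖) (fun N => norm_fejerMean_le hA N.succ_pos)
    (dense_span_range isHilbertSum_wordEmbedding) ?_
  rintro _ ⟨β, x, rfl⟩
  exact tendsto_of_multipliers isHilbertSum_wordEmbedding x
    (fun N γ => fejerWeight (N + 1) β.length γ.length) (fun N γ => fejerWeight_nonneg _ _ _)
    (fun N γ => fejerWeight_le_one _ _ _)
    (fun γ => (tendsto_fejerWeight _ _).comp (tendsto_add_atTop_nat 1))
    fun N γ => coord_fejerMean _ hA β γ x

end Fejer

end

theorem corollary1p3 (n : ℕ) (hn : 1 ≤ n) (E : Type*) [NormedAddCommGroup E]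
    [InnerProductSpace ℂ E] [CompleteSpace E] :
    {A : HilbertTensor E (Fock n) →L[ℂ] HilbertTensor E (Fock n) | IsMultiToeplitz n E A} =
        wotClosure (discOperatorSystem n E) ∧
      wotClosure (discOperatorSystem n E) = sotClosure (discOperatorSystem n E) := by
  have h1 : {A : HilbertTensor E (Fock n) →L[ℂ] HilbertTensor E (Fock n) |
      IsMultiToeplitz n E A} ⊆ sotClosure (discOperatorSystem n E) :=
    fun A hA => mem_sotClosure_of_isMultiToeplitz hA
  have h2 := sotClosure_subset_wotClosure (discOperatorSystem n E)
  have h3 := wotClosure_discOperatorSystem_subset (n := n) (E := E)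
  exact ⟨(h1.trans h2).antisymm h3, (h3.trans h1).antisymm h2⟩
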